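/- **Setting.** Let $\mathbf V=\{V_i\}_{i\in\iota}$ be finitely many variables, each with a finite domain having at least two values. A (recursive) *SCM* over $\mathbf V$ consists of exogenous variables $\mathbf U_0$ with an arbitrary joint law and, for each $i$, a measurable mechanism $f_i$ computing $V_i$ from a subset of $\mathbf V$ (its parents) and a subset of $\mathbf U_0$, the parent relation being acyclic. The intervention $do(\mathbf X=\mathbf x')$ replaces the mechanisms of the variables in $\mathbf X\subseteq\mathbf V$ by the constants $\mathbf x'$; $\mathbf V(u)$ and $\mathbf V_{\mathbf x'}(u)$ denote the solutions before and after it. An *augmented SCM (ASCM)* over a generative-level SCM $\mathcal M_0$ adds exogenous variables $\mathbf U_{\mathbf I}$ (possibly dependent on $\mathbf U_0$; the law of $\mathbf U_0$ is that of $\mathcal M_0$) and an $m$-dimensional image $\mathbf I=f_{\mathbf I}(\mathbf V,\mathbf U_{\mathbf I})$ with values in $D^m$, where $D$ is a measurable space of pixel values with measurable points, such that $h(f_{\mathbf I}(\mathbf v,\mathbf u_{\mathbf I}))=\mathbf v$ always, for some measurable labelling function $h$. Its observational distribution is $P(\mathbf V,\mathbf I)$, and its image counterfactual distribution is the joint law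 $P(\mathbf I,\mathbf I_{\mathbf x'})$ of $\mathbf I=f_{\mathbf I}(\mathbf V,\mathbf U_{\mathbf I})$ and $\mathbf I_{\mathbf x'}=f_{\mathbf I}(\mathbf V_{\mathbf x'},\mathbf U_{\mathbf I})$. Fix a causal order (a linear order on $\iota$). An SCM compatible with this order (parents precede children) is encoded by the joint distribution of its response functions: the probability vector $q$, indexed by the families $r=(r_i)_i$ of functions $r_i$ from values of the predecessors of $V_i$ to values of $V_i$, where $q_r$ is the probability that $\mathbf U_0$ turns the mechanisms into $r$. This encodes SCMs, up to having the same counterfactual distributions over $\mathbf V$, by the points of a probability simplex. **Theorem.** Let $\emptyset\neq\mathbf X\subseteq\mathbf V$, where $\mathbf X\ne\mathbf V$ or the image space $D^m$ is uncountable, and let $\mathbf x'$ be values of $\mathbf X$. Then for Lebesgue-almost every point $q$ of the simplex, for every SCM $\mathcal M_0$ compatible with the order and encoded by $q$, and for every ASCM $\mathcal M$ over $\mathcal M_0$ with images in $D^m$: 1. $P^{\mathcal M}(\mathbf I,\mathbf I_{\mathbf x'})$ is not uniquely determined by $P^{\mathcal M}(\mathbf V,\mathbf I)$: there is an ASCM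 $\mathcal M'$ (over some acyclic SCM on $\mathbf V$, with images in $D^m$) with $P^{\mathcal M'}(\mathbf V,\mathbf I)=P^{\mathcal M}(\mathbf V,\mathbf I)$ and $P^{\mathcal M'}(\mathbf I,\mathbf I_{\mathbf x'})\neq P^{\mathcal M}(\mathbf I,\mathbf I_{\mathbf x'})$. 2. It is not computable from samples either: there is no function $T$ of an infinite i.i.d. sample of $(\mathbf V,\mathbf I)$ such that, for every ASCM $\mathcal N$ (over an acyclic SCM on $\mathbf V$, with images in $D^m$) with $P^{\mathcal N}(\mathbf V,\mathbf I)=P^{\mathcal M}(\mathbf V,\mathbf I)$, the value of $T$ on a sample from $P^{\mathcal N}(\mathbf V,\mathbf I)$ almost surely equals $P^{\mathcal N}(\mathbf I,\mathbf I_{\mathbf x'})$. -/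

import Mathlib

open MeasureTheory

universe u

/-- An acyclic structural causal model over endogenous variables indexed by `ι`, the variable `i`
having domain `val i`. The exogenous variables are indexed by `κ`, with domains `dom k` and an
arbitrary joint law `P` (they may be dependent). The mechanism `f i` reads only the endogenous
parents `pa i` and the exogenous variables `exo i`. -/
structure SCM {ι : Type u} (val : ι → Type u) [∀ i, MeasurableSpace (val i)] where
  κ : Type u
  dom : κ → Type u
  [mdom : ∀ k, MeasurableSpace (dom k)]
  P : Measure (∀ k, dom k)
  [isProb : IsProbabilityMeasure P]
  pa : ι → Set ι
  exo : ι → Set κ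
  f : ∀ i, (∀ j : pa i, val j) → (∀ k : exo i, dom k) → val i
  measurable_f : ∀ i, Measurable fun p : (∀ j : pa i, val j) × (∀ k : exo i, dom k) => f i p.1 p.2
  acyclic : WellFounded fun j i => j ∈ pa i

attribute [instance] SCM.mdom SCM.isProb

namespace SCM

variable {ι : Type u} {val : ι → Type u} [∀ i, MeasurableSpace (val i)]

/-- The values of all endogenous variables when the exogenous variables equal `u`: the unique
solution of the structural equations. -/
noncomputable def solve (M : SCM val) (u : ∀ k, M.dom k) : ∀ i, val i :=
  M.acyclic.fix fun i ih => M.f i (fun j => ih j.1 j.2) (fun k => u k)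

theorem solve_eq (M : SCM val) (u : ∀ k, M.dom k) (i : ι) :
    M.solve u i = M.f i (fun j => M.solve u j) (fun k => u k) :=
  M.acyclic.fix_eq _ i

theorem measurable_solve (M : SCM val) : Measurable M.solve := by
  refine measurable_pi_lambda _ fun i => ?_
  induction i using M.acyclic.induction with
  | _ i ih =>
    have h : (fun u => M.solve u i) =
        fun u => M.f i (fun j => M.solve u j) (fun k => u k) := funext fun u => M.solve_eq u i
    rw [h]
    exact (M.measurable_f i).comp
      ((measurable_pi_lambda _ fun j => ih j.1 j.2).prodMk
        (measurable_pi_lambda _ fun k => measurable_pi_apply _))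

open Classical in
/-- The submodel induced by the intervention `do(X = x)`: the mechanisms of the variables in `X` are
replaced by constants, everything else is unchanged. -/
noncomputable def intervene (M : SCM val) (X : Set ι) (x : ∀ i : X, val i) : SCM val where
  κ := M.κ
  dom := M.dom
  P := M.P
  pa := M.pa
  exo := M.exo
  f i p u := if h : i ∈ X then x ⟨i, h⟩ else M.f i p u
  measurable_f i := by
    by_cases h : i ∈ X
    · simp [h]
    · simpa [h] using M.measurable_f i
  acyclic := M.acyclic

/-- The potential outcome `V_x(u)` of all endogenous variables. -/
noncomputable def potential (M : SCM val) (X : Set ι) (x : ∀ i : X, val i) (u : ∀ k, M.dom k) :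
    ∀ i, val i :=
  (M.intervene X x).solve u

theorem measurable_potential (M : SCM val) (X : Set ι) (x : ∀ i : X, val i) :
    Measurable (M.potential X x) :=
  (M.intervene X x).measurable_solve

end SCM

/-- An augmented SCM over the generative-level SCM `M₀`, with image space `Im`. `UI` is the joint
domain of the exogenous image variables, which may depend on those of `M₀`. The image mechanism `fI`
is invertible regarding the generative factors: a labelling function recovers them from the image. -/
structure ASCM {ι : Type u} {val : ι → Type u} [∀ i, MeasurableSpace (val i)] (M₀ : SCM val)
    (Im : Type u) [MeasurableSpace Im] where
  UI : Type u
  [mUI : MeasurableSpace UI]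
  P : Measure ((∀ k, M₀.dom k) × UI)
  marginal : P.map Prod.fst = M₀.P
  fI : (∀ i, val i) → UI → Im
  measurable_fI : Measurable fun p : (∀ i, val i) × UI => fI p.1 p.2
  invertible : ∃ h : Im → ∀ i, val i, Measurable h ∧ ∀ v w, h (fI v w) = v

attribute [instance] ASCM.mUI

namespace ASCM

variable {ι : Type u} {val : ι → Type u} [∀ i, MeasurableSpace (val i)] {M₀ : SCM val}
  {Im : Type u} [MeasurableSpace Im]

theorem isProbabilityMeasure (M : ASCM M₀ Im) : IsProbabilityMeasure M.P := by
  have h : M.P.map Prod.fst Set.univ = 1 := by rw [M.marginal]; exact measure_univ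
  rw [Measure.map_apply measurable_fst MeasurableSet.univ] at h
  exact ⟨by simpa using h⟩

/-- The image `I(u)`. -/
noncomputable def image (M : ASCM M₀ Im) (u : (∀ k, M₀.dom k) × M.UI) : Im :=
  M.fI (M₀.solve u.1) u.2

/-- The counterfactual image `I_x(u)`. -/
noncomputable def imageDo (M : ASCM M₀ Im) (X : Set ι) (x : ∀ i : X, val i)
    (u : (∀ k, M₀.dom k) × M.UI) : Im :=
  M.fI (M₀.potential X x u.1) u.2

theorem measurable_image (M : ASCM M₀ Im) : Measurable M.image :=
  M.measurable_fI.comp ((M₀.measurable_solve.comp measurable_fst).prodMk measurable_snd)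

theorem measurable_imageDo (M : ASCM M₀ Im) (X : Set ι) (x : ∀ i : X, val i) :
    Measurable (M.imageDo X x) :=
  M.measurable_fI.comp
    (((M₀.measurable_potential X x).comp measurable_fst).prodMk measurable_snd)

/-- The observational distribution `P(V, I)`. -/
noncomputable def obs (M : ASCM M₀ Im) : Measure ((∀ i, val i) × Im) :=
  M.P.map fun u => (M₀.solve u.1, M.image u)

/-- The image counterfactual distribution `P(I, I_x)`. -/
noncomputable def imageCtf (M : ASCM M₀ Im) (X : Set ι) (x : ∀ i : X, val i) :
    Measure (Im × Im) :=
  M.P.map fun u => (M.image u, M.imageDo X x u)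

instance (M : ASCM M₀ Im) : IsProbabilityMeasure M.obs :=
  haveI := M.isProbabilityMeasure
  Measure.isProbabilityMeasure_map
    ((M₀.measurable_solve.comp measurable_fst).prodMk M.measurable_image).aemeasurable

instance (M : ASCM M₀ Im) (X : Set ι) (x : ∀ i : X, val i) :
    IsProbabilityMeasure (M.imageCtf X x) :=
  haveI := M.isProbabilityMeasure
  Measure.isProbabilityMeasure_map
    (M.measurable_image.prodMk (M.measurable_imageDo X x)).aemeasurable

/-- `P(I, I_x)` is uniquely computable from `P(V, I)`: every ASCM with the same observational
distribution as `M` (over any acyclic generative level) has the same `P(I, I_x)`. -/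
def UniquelyComputable (M : ASCM M₀ Im) (X : Set ι) (x : ∀ i : X, val i) : Prop :=
  ∀ (N₀ : SCM val) (N : ASCM N₀ Im), N.obs = M.obs → N.imageCtf X x = M.imageCtf X x

/-- `P(I, I_x)` is computable from samples: some function of an infinite i.i.d. sample of `(V, I)`
(in particular, possibly of only finitely many of its entries) almost surely returns the correct
`P(I, I_x)`, whichever ASCM with the observational distribution of `M` generates the data. -/
def ComputableFromSamples (M : ASCM M₀ Im) (X : Set ι) (x : ∀ i : X, val i) : Prop :=
  ∃ T : (ℕ → (∀ i, val i) × Im) → Measure (Im × Im),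
    ∀ (N₀ : SCM val) (N : ASCM N₀ Im), N.obs = M.obs →
      ∀ᵐ s ∂(Measure.infinitePi fun _ : ℕ => N.obs), T s = N.imageCtf X x

end ASCM

/-- Profiles of response functions relative to a causal order `<`: for each variable, a function from
the values of its predecessors to its own values. -/
def Profile {ι : Type u} [LinearOrder ι] (val : ι → Type u) : Type u :=
  ∀ i, (∀ j : {j // j < i}, val j) → val i

instance {ι : Type u} [LinearOrder ι] [Finite ι] (val : ι → Type u) [∀ i, Finite (val i)] :
    Finite (Profile val) :=
  inferInstanceAs (Finite (∀ i, (∀ j : {j // j < i}, val j) → val i))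

noncomputable instance {ι : Type u} [LinearOrder ι] [Finite ι] (val : ι → Type u)
    [∀ i, Finite (val i)] : Fintype (Profile val) :=
  Fintype.ofFinite _

namespace SCM

variable {ι : Type u} [LinearOrder ι] {val : ι → Type u} [∀ i, MeasurableSpace (val i)]

/-- The causal order of the model is `<`: parents precede their children. -/
def RespectsOrder (M : SCM val) : Prop :=
  ∀ i, ∀ j ∈ M.pa i, j < i

/-- The response functions that the mechanisms become once the exogenous variables are fixed. -/
def response (M : SCM val) (hM : M.RespectsOrder) (u : ∀ k, M.dom k) : Profile val :=
  fun i w => M.f i (fun j => w ⟨j, hM i j j.2⟩) (fun k => u k)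

/-- The probabilities of the response profiles. Two models with causal order `<` have the same
family of counterfactual distributions exactly when these probabilities coincide, so that this
encodes the counterfactual equivalence classes of such models as points of a simplex. -/
noncomputable def encoding (M : SCM val) (hM : M.RespectsOrder) : Profile val → ℝ :=
  fun r => M.P.real {u | M.response hM u = r}

end SCM

/-- Lebesgue measure (up to a positive constant factor) on the probability simplex over a finite set
`R`: Hausdorff measure of dimension `|R| - 1`, restricted to the simplex. -/
noncomputable def simplexMeasure (R : Type u) [Fintype R] : Measure (R → ℝ) :=
  (Measure.hausdorffMeasure ((Fintype.card R : ℝ) - 1)).restrict (stdSimplex ℝ R)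

/-! Off a face of lower dimension, the constant response profile `c`, chosen with `c i ≠ x' i` on
`X`, has positive probability, so the intervention changes factual values with positive probability
(`measure_solve_eq_ne_zero`). It remains to exhibit two models with the given observations that
disagree on such units; a function of samples sees the same law in both and cannot return two
answers (`not_computable_of_ne`).

If some variable `i` lies outside `X`, take the factual values as exogenous and let `i` depend on a
single `j ∈ X`: when `j` deviates, `i` either keeps its value or changes it, and the labels of the
two images reveal which (`not_computable_of_notMem`). If `X` is everything, the counterfactual
factors are constant and only the rendering is free: a deviating unit may show either a fresh image
of probability zero or an old one (`not_computable_of_uncountable`). -/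

/-! ### Faces of the simplex are null -/

/-- The coordinates other than `r` and `r'` parametrize the face smoothly: `r` contributes zero and
`r'` is fixed by the total mass. -/
theorem dimH_simplex_face_le {R : Type*} [Fintype R] {r r' : R} (hr : r ≠ r') :
    dimH ({q : R → ℝ | q r = 0} ∩ stdSimplex ℝ R) ≤ (Fintype.card R - 2 : ℕ) := by
  classical
  let K := {k : R // k ∉ ({r, r'} : Finset R)}
  let φ : (K → ℝ) → R → ℝ := fun p k =>
    if h : k ∉ ({r, r'} : Finset R) then p ⟨k, h⟩ else if k = r then 0 else 1 - ∑ l, p l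
  have hφ : ContDiff ℝ 1 φ := by
    rw [contDiff_pi]
    intro k
    by_cases h : k ∉ ({r, r'} : Finset R)
    · simp only [φ, dif_pos h]
      fun_prop
    · by_cases hk : k = r
      · simp only [φ, dif_neg h, if_pos hk]
        fun_prop
      · simp only [φ, dif_neg h, if_neg hk]
        fun_prop
  have hsub : {q : R → ℝ | q r = 0} ∩ stdSimplex ℝ R ⊆ Set.range φ := by
    rintro q ⟨hq, -, hsum⟩
    refine ⟨fun k => q k, funext fun k => ?_⟩
    by_cases h : k ∉ ({r, r'} : Finset R)
    · simp only [φ, dif_pos h]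
    · by_cases hk : k = r
      · simp only [φ, dif_neg h, if_pos hk]
        rw [hk]
        exact hq.symm
      · simp only [φ, dif_neg h, if_neg hk]
        have hk' : k = r' := by simpa [hk] using h
        have h1 := Finset.sum_compl_add_sum ({r, r'} : Finset R) q
        rw [Finset.sum_pair hr, hsum, show q r = 0 from hq, zero_add] at h1
        have h2 : ∑ l : K, q l = ∑ l ∈ ({r, r'} : Finset R)ᶜ, q l :=
          (Finset.sum_subtype _ (fun x => Finset.mem_compl) q).symm
        rw [h2, hk']
        linarith
  refine (dimH_mono hsub).trans (hφ.dimH_range_le.trans ?_)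
  have hcard : Fintype.card K = Fintype.card R - 2 := by
    rw [Fintype.card_subtype, Finset.filter_notMem_eq_sdiff, ← Finset.compl_eq_univ_sdiff,
      Finset.card_compl, Finset.card_pair hr]
  rw [Module.finrank_fintype_fun_eq_card, hcard]

/-- Almost every point of a simplex with at least two vertices has nonzero coordinates. -/
theorem ae_simplexMeasure_ne_zero {R : Type u} [Fintype R] [Nontrivial R] (r : R) :
    ∀ᵐ q ∂(simplexMeasure R), q r ≠ 0 := by
  obtain ⟨r', hr⟩ := exists_ne r
  have hcard : 1 < Fintype.card R := Fintype.one_lt_card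
  have hmeas : MeasurableSet {q : R → ℝ | q r = 0} :=
    measurable_pi_apply r (measurableSet_singleton 0)
  have hd : ((Fintype.card R : ℝ) - 1) = (((Fintype.card R - 1 : ℕ) : NNReal) : ℝ) := by
    rw [NNReal.coe_natCast, Nat.cast_sub hcard.le, Nat.cast_one]
  rw [ae_iff]
  simp only [not_not, simplexMeasure]
  rw [Measure.restrict_apply hmeas, hd]
  refine hausdorffMeasure_of_dimH_lt ((dimH_simplex_face_le hr.symm).trans_lt ?_)
  -- Strict despite truncated subtraction, since there are at least two vertices.
  have : Fintype.card R - 2 < Fintype.card R - 1 := by omega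
  exact_mod_cast this

/-! ### Generative levels built from factual values -/

namespace SCM

variable {ι : Type u} {val : ι → Type u} [∀ i, MeasurableSpace (val i)]

theorem potential_of_mem (M : SCM val) {X : Set ι} (x : ∀ i : X, val i) (u : ∀ k, M.dom k)
    {i : ι} (hi : i ∈ X) : M.potential X x u i = x ⟨i, hi⟩ :=
  ((M.intervene X x).solve_eq u i).trans (dif_pos hi)

theorem potential_of_notMem (M : SCM val) {X : Set ι} (x : ∀ i : X, val i) (u : ∀ k, M.dom k)
    {i : ι} (hi : i ∉ X) :
    M.potential X x u i = M.f i (fun j => M.potential X x u j) (fun k => u k) :=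
  ((M.intervene X x).solve_eq u i).trans (dif_neg hi)

variable [Finite ι] [∀ i, Finite (val i)] [∀ i, DiscreteMeasurableSpace (val i)]

open Classical in
/-- The model whose exogenous variable is the profile `a` of factual values; a variable takes the
value `σ (a i)` if its parents deviate from their factual values. -/
noncomputable def ofValues (P : Measure (∀ i, val i)) [IsProbabilityMeasure P] (pa : ι → Set ι)
    (hpa : WellFounded fun j i => j ∈ pa i) (σ : ∀ i, val i → val i) : SCM val where
  κ := PUnit
  dom _ := ∀ i, val i
  P := P.map fun a _ => a
  isProb := Measure.isProbabilityMeasure_map (by fun_prop)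
  pa := pa
  exo _ := Set.univ
  f i p e :=
    if ∀ j : pa i, p j = e ⟨PUnit.unit, trivial⟩ j then e ⟨PUnit.unit, trivial⟩ i
    else σ i (e ⟨PUnit.unit, trivial⟩ i)
  measurable_f i := by
    have he : ∀ j, Measurable fun p : (∀ j : pa i, val j) ×
        (∀ _ : (Set.univ : Set PUnit.{u + 1}), ∀ i, val i) => p.2 ⟨PUnit.unit, trivial⟩ j :=
      fun j => by fun_prop
    refine Measurable.ite ?_ (he i) ((Measurable.of_discrete (f := σ i)).comp (he i))
    rw [Set.ofPred_forall]
    exact MeasurableSet.iInter fun j => measurableSet_eq_fun (by fun_prop) (he j)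
  acyclic := hpa

variable (P : Measure (∀ i, val i)) [IsProbabilityMeasure P] (pa : ι → Set ι)
    (hpa : WellFounded fun j i => j ∈ pa i) (σ : ∀ i, val i → val i)

theorem solve_ofValues (a : ∀ i, val i) :
    (ofValues P pa hpa σ).solve (fun _ => a) = a := by
  funext i
  induction i using hpa.induction with
  | _ i ih => exact (solve_eq _ _ i).trans (if_pos fun j : pa i => ih j.1 j.2)

open Classical in
-- Since `j` is the only parent of `i` and is held at `x`, the deviation test reduces to comparing
-- `x` with `a` at `j`.
theorem potential_ofValues {X : Set ι} (x : ∀ i : X, val i) (a : ∀ i, val i) {i j : ι}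
    (hi : i ∉ X) (hj : j ∈ X) (hij : pa i = {j}) :
    (ofValues P pa hpa σ).potential X x (fun _ => a) i =
      if x ⟨j, hj⟩ = a j then a i else σ i (a i) := by
  refine (potential_of_notMem _ _ _ hi).trans (if_congr ⟨fun h => ?_, fun h k => ?_⟩ rfl rfl)
  · have h' := h ⟨j, by rw [hij]; rfl⟩
    exact (potential_of_mem _ _ _ hj).symm.trans h'
  · obtain ⟨k, hk⟩ := k
    change k ∈ pa i at hk
    rw [hij, Set.mem_singleton_iff] at hk
    subst hk
    exact (potential_of_mem _ _ _ hj).trans h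

end SCM

/-! ### From two models to non-computability -/

namespace ASCM

variable {ι : Type u} {val : ι → Type u} [∀ i, MeasurableSpace (val i)] {M₀ : SCM val}
  {Im : Type u} [MeasurableSpace Im]

/-- Two observationally equivalent models with distinct counterfactuals refute both notions of
computability. -/
theorem not_computable_of_ne (M : ASCM M₀ Im) (X : Set ι) (x : ∀ i : X, val i)
    {N₀ N₀' : SCM val} (N : ASCM N₀ Im) (N' : ASCM N₀' Im) (hN : N.obs = M.obs)
    (hN' : N'.obs = M.obs) (hne : N.imageCtf X x ≠ N'.imageCtf X x) :
    ¬ M.UniquelyComputable X x ∧ ¬ M.ComputableFromSamples X x := by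
  refine ⟨fun h => hne ((h N₀ N hN).trans (h N₀' N' hN').symm), fun ⟨T, hT⟩ => hne ?_⟩
  have h1 := hT N₀ N hN
  have h2 := hT N₀' N' hN'
  rw [hN] at h1
  rw [hN'] at h2
  obtain ⟨s, hs1, hs2⟩ := (h1.and h2).exists
  exact hs1.symm.trans hs2

theorem measurable_obs (M : ASCM M₀ Im) : Measurable fun u => (M₀.solve u.1, M.image u) :=
  (M₀.measurable_solve.comp measurable_fst).prodMk M.measurable_image

theorem measurable_imageCtf (M : ASCM M₀ Im) (X : Set ι) (x : ∀ i : X, val i) :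
    Measurable fun u => (M.image u, M.imageDo X x u) :=
  M.measurable_image.prodMk (M.measurable_imageDo X x)

theorem isProbabilityMeasure_map_solve (M₀ : SCM val) :
    IsProbabilityMeasure (M₀.P.map M₀.solve) :=
  Measure.isProbabilityMeasure_map M₀.measurable_solve.aemeasurable

theorem measurable_regenerate (M : ASCM M₀ Im) : Measurable fun u : (∀ k, M₀.dom k) × M.UI =>
    ((fun _ => M₀.solve u.1, u.2) : (PUnit.{u + 1} → ∀ i, val i) × M.UI) := by
  have hs := M₀.measurable_solve
  fun_prop

theorem measurable_replaceImages (M : ASCM M₀ Im) :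
    Measurable fun u : (∀ k, M₀.dom k) × M.UI => (u.1, M₀.solve u.1, u.2) := by
  have hs := M₀.measurable_solve
  fun_prop

/-! ### Some variable is not intervened on -/

section RegenerateFactors

variable [Finite ι] [∀ i, Finite (val i)] [∀ i, DiscreteMeasurableSpace (val i)]

attribute [local instance] isProbabilityMeasure_map_solve

/-- The model with the image mechanism of `M` whose generative level is regenerated from the factual
values. -/
noncomputable def regenerate (M : ASCM M₀ Im) (pa : ι → Set ι)
    (hpa : WellFounded fun j i => j ∈ pa i) (σ : ∀ i, val i → val i) :
    ASCM (SCM.ofValues (M₀.P.map M₀.solve) pa hpa σ) Im where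
  UI := M.UI
  P := M.P.map fun u => (fun _ => M₀.solve u.1, u.2)
  marginal := by
    have hs := M₀.measurable_solve
    have hP : M₀.P.map M₀.solve = M.P.map fun u => M₀.solve u.1 := by
      rw [← M.marginal, Measure.map_map hs measurable_fst]
      rfl
    have hP' : (M₀.P.map M₀.solve).map (fun a (_ : PUnit.{u + 1}) => a) =
        M.P.map fun u _ => M₀.solve u.1 := by
      rw [hP, Measure.map_map (by fun_prop) (by fun_prop)]
      rfl
    exact (Measure.map_map measurable_fst M.measurable_regenerate).trans hP'.symm
  fI := M.fI
  measurable_fI := M.measurable_fI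
  invertible := M.invertible

variable (M : ASCM M₀ Im) (pa : ι → Set ι) (hpa : WellFounded fun j i => j ∈ pa i)
  (σ : ∀ i, val i → val i)

/-- Observations depend only on `fI` and the joint law of the factual values and the image noise,
and both are retained. -/
theorem obs_regenerate : (M.regenerate pa hpa σ).obs = M.obs := by
  refine (Measure.map_map (M.regenerate pa hpa σ).measurable_obs M.measurable_regenerate).trans ?_
  refine congrArg (fun g => M.P.map g) (funext fun u => ?_)
  change ((SCM.ofValues _ pa hpa σ).solve (fun _ => M₀.solve u.1),
    M.fI ((SCM.ofValues _ pa hpa σ).solve (fun _ => M₀.solve u.1)) u.2) = _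
  rw [SCM.solve_ofValues]
  rfl

theorem imageCtf_regenerate (X : Set ι) (x : ∀ i : X, val i) :
    (M.regenerate pa hpa σ).imageCtf X x = M.P.map fun u => (M.image u,
      M.fI ((SCM.ofValues (M₀.P.map M₀.solve) pa hpa σ).potential X x fun _ => M₀.solve u.1)
        u.2) := by
  refine (Measure.map_map ((M.regenerate pa hpa σ).measurable_imageCtf X x)
    M.measurable_regenerate).trans ?_
  refine congrArg (fun g => M.P.map g) (funext fun u => ?_)
  change (M.fI ((SCM.ofValues _ pa hpa σ).solve (fun _ => M₀.solve u.1)) u.2, _) = _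
  rw [SCM.solve_ofValues]
  rfl

theorem measurable_imageCtf_regenerate (X : Set ι) (x : ∀ i : X, val i) :
    Measurable fun u : (∀ k, M₀.dom k) × M.UI => (M.image u,
      M.fI ((SCM.ofValues (M₀.P.map M₀.solve) pa hpa σ).potential X x fun _ => M₀.solve u.1)
        u.2) :=
  M.measurable_image.prodMk
    (((M.regenerate pa hpa σ).measurable_imageDo X x).comp M.measurable_regenerate)

theorem not_computable_of_notMem [∀ i, Nontrivial (val i)] {X : Set ι} (x : ∀ i : X, val i)
    {i j : ι} (hi : i ∉ X) (hj : j ∈ X) (hpos : M.P {u | M₀.solve u.1 j ≠ x ⟨j, hj⟩} ≠ 0) :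
    ¬ M.UniquelyComputable X x ∧ ¬ M.ComputableFromSamples X x := by
  have hij : j ≠ i := fun h => hi (h ▸ hj)
  -- The only edge is `j → i`.
  let pa : ι → Set ι := fun k => {l | k = i ∧ l = j}
  have hpai : pa i = {j} := by ext; simp [pa]
  have hpa : WellFounded fun l k => l ∈ pa k :=
    ⟨fun k => ⟨k, fun l hl => ⟨l, fun l' hl' => (hij (hl.2.symm.trans hl'.1)).elim⟩⟩⟩
  choose σ hσ using fun k => fun v : val k => exists_ne v
  obtain ⟨h, hh, hinv⟩ := M.invertible
  refine M.not_computable_of_ne X x (M.regenerate pa hpa fun _ => id) (M.regenerate pa hpa σ)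
    (M.obs_regenerate _ _ _) (M.obs_regenerate _ _ _) fun heq => ?_
  rw [imageCtf_regenerate, imageCtf_regenerate] at heq
  -- The labels at `i` disagree: impossible for `id`, certain for the fixed-point-free `σ` whenever
  -- `j` deviates.
  let S : Set (Im × Im) := {p | h p.1 i = h p.2 i}ᶜ
  have hS : MeasurableSet S := (measurableSet_eq_fun (by fun_prop) (by fun_prop)).compl
  have heq' := DFunLike.congr_fun heq S
  rw [Measure.map_apply (M.measurable_imageCtf_regenerate _ _ _ _ _) hS,
    Measure.map_apply (M.measurable_imageCtf_regenerate _ _ _ _ _) hS] at heq'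
  refine hpos (measure_mono_null (fun u hu => ?_) (heq'.symm.trans ?_))
  · change ¬ (h (M.fI (M₀.solve u.1) u.2) i = h (M.fI _ u.2) i)
    rw [hinv, hinv, SCM.potential_ofValues _ _ _ _ _ _ hi hj hpai, if_neg fun h => hu h.symm]
    exact (hσ i _).symm
  · convert measure_empty (μ := M.P)
    refine Set.eq_empty_of_forall_notMem fun u hu => hu ?_
    change h (M.fI (M₀.solve u.1) u.2) i = h (M.fI _ u.2) i
    rw [hinv, hinv, SCM.potential_ofValues _ _ _ _ _ _ hi hj hpai, id, ite_self]

end RegenerateFactors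

/-! ### All variables are intervened on -/

section ReplaceImages

variable [Finite ι] [∀ i, Finite (val i)] [∀ i, DiscreteMeasurableSpace (val i)]

open Classical in
/-- The model that follows the image mechanism `F` as long as the generative factors keep their
factual values, and renders the fixed image `g w` for any other values `w` of them. -/
noncomputable def replaceImages (M : ASCM M₀ Im) (F : (∀ i, val i) → M.UI → Im)
    (hF : Measurable fun p : (∀ i, val i) × M.UI => F p.1 p.2) (g : (∀ i, val i) → Im)
    (h : Im → ∀ i, val i) (hh : Measurable h) (hhF : ∀ v w, h (F v w) = v) (hg : ∀ v, h (g v) = v) :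
    ASCM M₀ Im where
  -- The image noise may depend on the generative noise, so it can carry the factual values.
  UI := (∀ i, val i) × M.UI
  P := M.P.map fun u => (u.1, M₀.solve u.1, u.2)
  marginal := by
    have hs := M₀.measurable_solve
    rw [Measure.map_map measurable_fst (by fun_prop), ← M.marginal]
    rfl
  fI w p := if w = p.1 then F w p.2 else g w
  measurable_fI := Measurable.ite (measurableSet_eq_fun (by fun_prop) (by fun_prop))
    (hF.comp (by fun_prop : Measurable fun p : (∀ i, val i) × (∀ i, val i) × M.UI => (p.1, p.2.2)))
    ((Measurable.of_discrete (f := g)).comp measurable_fst)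
  invertible := ⟨h, hh, fun v w => by
    split_ifs
    · exact hhF _ _
    · exact hg _⟩

variable (M : ASCM M₀ Im) (F : (∀ i, val i) → M.UI → Im)
    (hF : Measurable fun p : (∀ i, val i) × M.UI => F p.1 p.2) (g : (∀ i, val i) → Im)
    (h : Im → ∀ i, val i) (hh : Measurable h) (hhF : ∀ v w, h (F v w) = v) (hg : ∀ v, h (g v) = v)

theorem obs_replaceImages (hae : ∀ᵐ u ∂M.P, F (M₀.solve u.1) u.2 = M.image u) :
    (M.replaceImages F hF g h hh hhF hg).obs = M.obs := by
  refine (Measure.map_map (M.replaceImages F hF g h hh hhF hg).measurable_obs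
    M.measurable_replaceImages).trans ?_
  refine Measure.map_congr ?_
  filter_upwards [hae] with u hu
  refine Prod.ext rfl (Eq.trans ?_ hu)
  exact if_pos rfl

open Classical in
theorem imageCtf_replaceImages_apply (x : ∀ i : (Set.univ : Set ι), val i) {S : Set (Im × Im)}
    (hS : MeasurableSet S) :
    (M.replaceImages F hF g h hh hhF hg).imageCtf Set.univ x S =
      M.P {u | (F (M₀.solve u.1) u.2,
        if (fun i => x ⟨i, trivial⟩) = M₀.solve u.1 then F (fun i => x ⟨i, trivial⟩) u.2
        else g fun i => x ⟨i, trivial⟩) ∈ S} := by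
  rw [imageCtf, Measure.map_apply (measurable_imageCtf _ _ _) hS]
  refine (Measure.map_apply M.measurable_replaceImages
    ((measurable_imageCtf _ _ _) hS)).trans ?_
  congr 1
  ext u
  have hx : M₀.potential Set.univ x u.1 = fun i => x ⟨i, trivial⟩ :=
    funext fun i => M₀.potential_of_mem x u.1 trivial
  have h1 : (M.replaceImages F hF g h hh hhF hg).image (u.1, M₀.solve u.1, u.2) =
      F (M₀.solve u.1) u.2 := if_pos rfl
  have h2 : (M.replaceImages F hF g h hh hhF hg).imageDo Set.univ x (u.1, M₀.solve u.1, u.2) =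
      if (fun i => x ⟨i, trivial⟩) = M₀.solve u.1 then F (fun i => x ⟨i, trivial⟩) u.2
        else g fun i => x ⟨i, trivial⟩ := by
    rw [← hx]
    rfl
  change ((M.replaceImages F hF g h hh hhF hg).image (u.1, M₀.solve u.1, u.2),
    (M.replaceImages F hF g h hh hhF hg).imageDo Set.univ x (u.1, M₀.solve u.1, u.2)) ∈ S ↔ _
  rw [h1, h2]
  rfl

/-- In an uncountable space, some point outside a given countable set has measure zero. -/
theorem exists_notMem_measure_singleton_eq_zero {α : Type*} [MeasurableSpace α]
    [MeasurableSingletonClass α] [Uncountable α] (μ : Measure α) [IsFiniteMeasure μ] {s : Set α}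
    (hs : s.Countable) : ∃ b ∉ s, μ {b} = 0 := by
  by_contra! hcon
  have hc : {b | 0 < μ {b}}.Countable :=
    Measure.countable_meas_pos_of_disjoint_iUnion (fun b => measurableSet_singleton b)
      fun a b hab => Set.disjoint_singleton.mpr hab
  refine Set.not_countable_univ (α := α) ((hs.union hc).mono fun b _ => ?_)
  by_cases hb : b ∈ s
  · exact Or.inl hb
  · exact Or.inr (pos_iff_ne_zero.mpr (hcon b hb))

theorem not_computable_of_uncountable [MeasurableSingletonClass Im] [Uncountable Im]
    (x : ∀ i : (Set.univ : Set ι), val i)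
    (hpos : M.P {u | M₀.solve u.1 ≠ fun i => x ⟨i, trivial⟩} ≠ 0) :
    ¬ M.UniquelyComputable Set.univ x ∧ ¬ M.ComputableFromSamples Set.univ x := by
  classical
  have := M.isProbabilityMeasure
  obtain ⟨h, hh, hinv⟩ := M.invertible
  obtain ⟨u₀⟩ : Nonempty ((∀ k, M₀.dom k) × M.UI) := nonempty_of_isProbabilityMeasure M.P
  -- Freezing the noise gives a section of `h` with finite range, which `b` can avoid.
  let s : (∀ i, val i) → Im := fun v => M.fI v u₀.2
  have hs : ∀ v, h (s v) = v := fun v => hinv v _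
  obtain ⟨b, hb, hb0⟩ := exists_notMem_measure_singleton_eq_zero (M.P.map M.image)
    (Set.countable_range s)
  have hbs : ∀ v, s v ≠ b := fun v hv => hb ⟨v, hv⟩
  rw [Measure.map_apply M.measurable_image (measurableSet_singleton b)] at hb0
  let x₀ : ∀ i, val i := fun i => x ⟨i, trivial⟩
  -- Removing `b` from the mechanism alters factual images only on a null event and frees `b` to be
  -- relabelled `x₀`.
  let F : (∀ i, val i) → M.UI → Im := fun v w => if M.fI v w = b then s v else M.fI v w
  have hF : Measurable fun p : (∀ i, val i) × M.UI => F p.1 p.2 :=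
    Measurable.ite (M.measurable_fI (measurableSet_singleton b))
      ((Measurable.of_discrete (f := s)).comp measurable_fst) M.measurable_fI
  have hFb : ∀ v w, F v w ≠ b := fun v w => by
    simp only [F]
    split_ifs with hv
    · exact hbs v
    · exact hv
  let h' : Im → ∀ i, val i := fun y => if y = b then x₀ else h y
  have hh' : Measurable h' := Measurable.ite (measurableSet_singleton b) measurable_const hh
  have hF' : ∀ v w, h' (F v w) = v := fun v w => by
    simp only [h', if_neg (hFb v w), F]
    split_ifs
    · exact hs v
    · exact hinv v w
  have hs' : ∀ v, h' (s v) = v := fun v => (if_neg (hbs v)).trans (hs v)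
  let g : (∀ i, val i) → Im := fun v => if v = x₀ then b else s v
  have hg : ∀ v, h' (g v) = v := fun v => by
    by_cases hv : v = x₀
    · simp [g, h', hv]
    · simp only [g, if_neg hv, hs' v]
  have hae : ∀ᵐ u ∂M.P, F (M₀.solve u.1) u.2 = M.image u := by
    rw [ae_iff]
    refine measure_mono_null (fun u hu => ?_) hb0
    by_contra hne
    exact hu (if_neg hne)
  refine M.not_computable_of_ne Set.univ x (M.replaceImages F hF g h' hh' hF' hg)
    (M.replaceImages F hF s h' hh' hF' hs') (M.obs_replaceImages _ _ _ _ _ _ _ hae)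
    (M.obs_replaceImages _ _ _ _ _ _ _ hae) fun heq => hpos ?_
  let S : Set (Im × Im) := {p | p.2 = b}
  have hS : MeasurableSet S := measurable_snd (measurableSet_singleton b)
  have heq' := DFunLike.congr_fun heq S
  rw [imageCtf_replaceImages_apply _ _ _ _ _ _ _ _ _ hS,
    imageCtf_replaceImages_apply _ _ _ _ _ _ _ _ _ hS] at heq'
  refine measure_mono_null (fun u hu => ?_) (heq'.trans ?_)
  · change (if x₀ = M₀.solve u.1 then _ else g x₀) = b
    rw [if_neg fun hx => hu hx.symm]
    exact if_pos rfl
  · convert measure_empty (μ := M.P)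
    refine Set.eq_empty_of_forall_notMem fun u hu => ?_
    change (if x₀ = M₀.solve u.1 then F x₀ u.2 else s x₀) = b at hu
    split_ifs at hu
    · exact hFb _ _ hu
    · exact hbs _ hu

end ReplaceImages

end ASCM

/-! ### Positive probability of a constant profile, and conclusion -/

namespace SCM

variable {ι : Type u} [LinearOrder ι] {val : ι → Type u} [∀ i, MeasurableSpace (val i)]

theorem solve_of_response_const (M : SCM val) (hM : M.RespectsOrder) (c : ∀ i, val i)
    {u : ∀ k, M.dom k} (hu : M.response hM u = fun i _ => c i) : M.solve u = c := by
  funext i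
  rw [solve_eq]
  exact congrFun (congrFun hu i) fun j => M.solve u j

/-- Constant responses ignore the predecessors and force the solution `c`. -/
theorem measure_solve_eq_ne_zero (M : SCM val) (hM : M.RespectsOrder) (c : ∀ i, val i)
    (hc : M.encoding hM (fun i _ => c i) ≠ 0) : M.P {u | M.solve u = c} ≠ 0 := fun h0 =>
  hc <| (measureReal_eq_zero_iff).mpr <|
    measure_mono_null (fun _ hu => M.solve_of_response_const hM c hu) h0

end SCM

theorem Profile.nontrivial {ι : Type u} [LinearOrder ι] [Nonempty ι] (val : ι → Type u)
    [∀ i, Nontrivial (val i)] : Nontrivial (Profile val) := by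
  choose a b hab using fun i => exists_pair_ne (val i)
  exact ⟨fun i _ => a i, fun i _ => b i, fun h => hab (Classical.arbitrary ι)
    (congrFun (congrFun h _) fun j => a j)⟩

theorem corollary1 {ι : Type u} [Finite ι] [LinearOrder ι] {val : ι → Type u}
    [∀ i, Finite (val i)] [∀ i, Nontrivial (val i)]
    [∀ i, MeasurableSpace (val i)] [∀ i, DiscreteMeasurableSpace (val i)]
    {m : ℕ} {Pixel : Type u} [MeasurableSpace Pixel] [MeasurableSingletonClass Pixel]
    (X : Set ι) (hX : X.Nonempty) (hX' : X ≠ Set.univ ∨ Uncountable (Fin m → Pixel))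
    (x' : ∀ i : X, val i) :
    ∀ᵐ q ∂(simplexMeasure (Profile val)),
      ∀ (M₀ : SCM val) (hM₀ : M₀.RespectsOrder), M₀.encoding hM₀ = q →
        ∀ M : ASCM M₀ (Fin m → Pixel),
          ¬ M.UniquelyComputable X x' ∧ ¬ M.ComputableFromSamples X x' := by
  classical
  obtain ⟨j, hj⟩ := hX
  have : Nonempty ι := ⟨j⟩
  have := Profile.nontrivial val
  -- Only the values on `X` matter; the default elsewhere is immaterial.
  choose c hc using fun i => exists_ne (if h : i ∈ X then x' ⟨i, h⟩ else Classical.arbitrary (val i))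
  filter_upwards [ae_simplexMeasure_ne_zero (R := Profile val) fun i _ => c i] with q hq M₀ hM₀ henc M
  have hcj : c j ≠ x' ⟨j, hj⟩ := by simpa [hj] using hc j
  have hV := M₀.measure_solve_eq_ne_zero hM₀ c (by rwa [henc])
  have hmeas : MeasurableSet {u | M₀.solve u = c} := M₀.measurable_solve (measurableSet_singleton c)
  rw [← M.marginal, Measure.map_apply measurable_fst hmeas] at hV
  by_cases hu : X = Set.univ
  · subst hu
    have := hX'.resolve_left fun h => h rfl
    refine M.not_computable_of_uncountable x' fun h0 => hV (measure_mono_null ?_ h0)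
    rintro u hu heq
    exact hcj ((congrFun (show M₀.solve u.1 = c from hu) j).symm.trans (congrFun heq j))
  · obtain ⟨i, hi⟩ := (Set.ne_univ_iff_exists_notMem X).mp hu
    refine M.not_computable_of_notMem x' hi hj fun h0 => hV (measure_mono_null ?_ h0)
    rintro u hu heq
    exact hcj ((congrFun (show M₀.solve u.1 = c from hu) j).symm.trans heq)
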